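/- Let $d\ge 0$ and $n\ge 1$ be integers and let $V=(v_{ik})\in\mathbb R^{d\times n}$ be a matrix with finite entries. Write $\Delta_{d-1}=\operatorname{conv}\{e_1,\dots,e_d\}\subset\mathbb R^d$. For a finite point configuration $A\subset\mathbb R^m$ and $\lambda:A\to\mathbb R$, the regular subdivision $\Sigma_\downarrow(A,\lambda)$ consists of the projections to $\mathbb R^m$ of the bounded faces (including $\emptyset$) of the polyhedron $\operatorname{conv}\{(a,\lambda(a)) : a\in A\}+\mathbb R_{\ge 0}(0,1)$ in $\mathbb R^m\times\mathbb R$. Let $\Sigma_\downarrow(V)$ be the regular subdivision of the support of the tropical polynomial $$F=\bigodot_{k=1}^n\ \bigoplus_{i=1}^d v_{ik}\odot x_i$$ over the min-plus semiring $(\mathbb R\cup\{\infty\},\min,+)$, where each exponent vector $m$ in the support is lifted to the coefficient of $x^{\odot m}$ in $F$. Then $\Sigma_\downarrow(V)$ is a regular mixed subdivision of $n\cdot\Delta_{d-1}$, in the sense that its cells cover exactly $n\cdot\Delta_{d-1}$ and each of them is a mixed cell $\operatorname{conv}(A'_1+\dots+A'_n)$ with $A'_1,\dots,A'_n\subseteq\{e_1,\dots,e_d\}$.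 Moreover, let $\Sigma$ be the regular subdivision of $\Delta_{d-1}\times\Delta_{n-1}\subset\mathbb R^d\times\mathbb R^n$ in which the vertex $(e_i,e_k)$ is lifted to $v_{ik}$. Then $\Sigma_\downarrow(V)$ is piecewise-linearly isomorphic to the slice $\{C\cap L : C\in\Sigma\}$ of $\Sigma$ by the affine subspace $L=\{(x,y)\in\mathbb R^d\times\mathbb R^n : y=(\tfrac1n,\dots,\tfrac1n)\}$. That is, there is a homeomorphism between the unions of the cells of the two complexes such that it and its inverse map cells to cells and are affine on every cell. -/

import Mathlib

open scoped Pointwise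

noncomputable section

/-- The polyhedron `U(A, h)` of a finite point configuration `A = {p i}` with height function `h`:
the convex hull of the lifted points plus the upward ray. -/
def extendedPolyhedron {ι E : Type*} [NormedAddCommGroup E] [NormedSpace ℝ E]
    (p : ι → E) (h : ι → ℝ) : Set (E × ℝ) :=
  convexHull ℝ (Set.range fun i => (p i, h i)) + {z : E × ℝ | z.1 = 0 ∧ 0 ≤ z.2}

/-- The regular subdivision of a finite point configuration: its cells are the projections of the
bounded faces of the extended polyhedron (the empty face is counted among the faces). -/
def regularSubdivision {ι E : Type*} [NormedAddCommGroup E] [NormedSpace ℝ E]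
    (p : ι → E) (h : ι → ℝ) : Set (Set E) :=
  {C | ∃ F : Set (E × ℝ), IsExposed ℝ (extendedPolyhedron p h) F ∧ Bornology.IsBounded F ∧
    C = Prod.fst '' F}

/-- Formal tropical polynomials in `d` variables (with nonnegative exponents) over the
min-plus semiring `ℝ ∪ {∞}`; the zero of `Tropical (WithTop ℝ)` is `∞`, so that
`MvPolynomial.support` is the set of exponents with a coefficient different from `∞`. -/
abbrev TropicalPolynomial (d : ℕ) : Type :=
  MvPolynomial (Fin d) (Tropical (WithTop ℝ))

/-- The tropical linear form `⊕ᵢ vᵢ ⊙ xᵢ`. -/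
def tropicalLinearForm {d : ℕ} (v : Fin d → WithTop ℝ) : TropicalPolynomial d :=
  ∑ i, MvPolynomial.C (Tropical.trop (v i)) * MvPolynomial.X i

/-- The regular subdivision of the support of a tropical polynomial, lifted by the coefficients.
(On the support every coefficient is finite, so the default value `0` is never used.) -/
def TropicalPolynomial.subdivision {d : ℕ} (F : TropicalPolynomial d) : Set (Set (Fin d → ℝ)) :=
  regularSubdivision (fun (m : F.support) (i : Fin d) => ((m : Fin d →₀ ℕ) i : ℝ))
    (fun m : F.support => (Tropical.untrop (F.coeff (m : Fin d →₀ ℕ))).untopD 0)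

/-- The regular subdivision attached to a matrix `V` over `ℝ ∪ {∞}`: that of the tropical product
of the tropical linear forms given by the columns of `V`. -/
def matrixSubdivision {d n : ℕ} (V : Matrix (Fin d) (Fin n) (WithTop ℝ)) :
    Set (Set (Fin d → ℝ)) :=
  TropicalPolynomial.subdivision (∏ k : Fin n, tropicalLinearForm fun i => V i k)

/-- All cells are mixed cells `conv (A'₁ + ⋯ + A'ₙ)` with labels `A'ₖ ⊆ Aₖ`. -/
def FormedFromMixedCells {n : ℕ} {E : Type*} [AddCommGroup E] [Module ℝ E]
    (A : Fin n → Set E) (K : Set (Set E)) : Prop :=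
  ∀ C ∈ K, ∃ A' : Fin n → Set E, (∀ k, A' k ⊆ A k) ∧ C = convexHull ℝ (∑ k, A' k)

/-- The regular subdivision of `Δ_{d-1} × Δ_{n-1}` in which the vertex `(eᵢ, eₖ)` is lifted
to `V i k`. -/
def productSubdivision {d n : ℕ} (V : Matrix (Fin d) (Fin n) ℝ) :
    Set (Set ((Fin d → ℝ) × (Fin n → ℝ))) :=
  regularSubdivision
    (fun ik : Fin d × Fin n => ((Pi.single ik.1 1 : Fin d → ℝ), (Pi.single ik.2 1 : Fin n → ℝ)))
    (fun ik => V ik.1 ik.2)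

/-- The slice of a collection of cells by an affine subspace. -/
def sliceComplex {E : Type*} [AddCommGroup E] [Module ℝ E]
    (K : Set (Set E)) (L : AffineSubspace ℝ E) : Set (Set E) :=
  {D | ∃ C ∈ K, D = C ∩ (L : Set E)}

/-- The affine subspace of `ℝᵈ × ℝⁿ` of all `(x, y)` where `y = (1/n, …, 1/n)` is the barycenter
of the simplex `Δ_{n-1}`. -/
def barycentricSubspace (d n : ℕ) : AffineSubspace ℝ ((Fin d → ℝ) × (Fin n → ℝ)) where
  carrier := {z | z.2 = fun _ => (1 : ℝ) / n}
  smul_vsub_vadd_mem' c p q r hp hq hr := by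
    simp only [Set.mem_ofPred_eq] at hp hq hr ⊢
    simp [hp, hq, hr]

/-- Piecewise linear isomorphism of polyhedral complexes: a homeomorphism between the underlying
spaces such that it and its inverse map cells to cells and are affine on every cell. -/
def PLIsomorphic {E F : Type*} [NormedAddCommGroup E] [NormedSpace ℝ E]
    [NormedAddCommGroup F] [NormedSpace ℝ F] (K : Set (Set E)) (L : Set (Set F)) : Prop :=
  ∃ (f : E → F) (g : F → E),
    ContinuousOn f (⋃₀ K) ∧ ContinuousOn g (⋃₀ L) ∧ Set.InvOn g f (⋃₀ K) (⋃₀ L) ∧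
    (∀ C ∈ K, f '' C ∈ L ∧ ∃ φ : E →ᵃ[ℝ] F, Set.EqOn f φ C) ∧
    (∀ D ∈ L, g '' D ∈ K ∧ ∃ ψ : F →ᵃ[ℝ] E, Set.EqOn g ψ D)

end

/-! The proof is the Cayley trick, carried out on supporting functionals. A bounded nonempty face of
the extended polyhedron is cut out by a non-vertical hyperplane, so a cell is the convex hull of the
points at which `h - a ∘ p` is minimal for some functional `a` (`mem_regularSubdivision_iff`).

Expanding the tropical product replaces the support by all maps `σ`, choosing one term from each
factor, with height `∑ k, V (σ k) k`. For this configuration the objective is a sum over `k` of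
terms depending only on `σ k`. Its minimisers are therefore chosen independently in each column, and
every cell is a mixed cell (`mem_lowerContact_sum_iff`).

On the product of simplices a functional splits as `a + b`, where `b` contributes one constant per
column. A cell meeting the barycentric slice must touch every column, and then its part in each
column is the column minimum for `a` alone. Its weights in each column sum to `1/n`, so up to the
factor `n` the slice is the mixed cell of `a`. Hence `x ↦ (x/n, 1/n, …, 1/n)` is the required
isomorphism.

The covering statement holds for regular subdivisions in general (`sUnion_regularSubdivision`). -/

/-- The indices at which the functional `a` supports the lifted configuration from below. -/
def lowerContact {ι E : Type*} [NormedAddCommGroup E] [NormedSpace ℝ E]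
    (p : ι → E) (h : ι → ℝ) (a : StrongDual ℝ E) : Set ι :=
  {i | ∀ j, h i - a (p i) ≤ h j - a (p j)}

/-! ### Convex hulls of finite families through weights -/

section ConvexHull

variable {ι E : Type*} [AddCommGroup E] [Module ℝ E]

theorem mem_convexHull_image_iff_exists_weights [Fintype ι] {p : ι → E} {S : Set ι} {x : E} :
    x ∈ convexHull ℝ (p '' S) ↔ ∃ w : ι → ℝ, (∀ i, 0 ≤ w i) ∧ (∀ i ∉ S, w i = 0) ∧
      ∑ i, w i = 1 ∧ ∑ i, w i • p i = x := by
  classical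
  constructor
  · intro hx
    refine convexHull_min (t := {x | ∃ w : ι → ℝ, (∀ i, 0 ≤ w i) ∧ (∀ i ∉ S, w i = 0) ∧
      ∑ i, w i = 1 ∧ ∑ i, w i • p i = x}) ?_ ?_ hx
    · rintro _ ⟨i, hi, rfl⟩
      refine ⟨Pi.single i 1, fun j => ?_, fun j hj => ?_, ?_, ?_⟩
      · by_cases hj : j = i
        · subst hj; simp
        · simp [hj]
      · exact Pi.single_eq_of_ne (by rintro rfl; exact hj hi) _
      · simp
      · simp [Pi.single_apply, ite_smul]
    · rintro _ ⟨w, hw, hwS, hw1, rfl⟩ _ ⟨u, hu, huS, hu1, rfl⟩ s t hs ht hst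
      refine ⟨fun i => s * w i + t * u i, fun i => ?_, fun i hi => ?_, ?_, ?_⟩
      · exact add_nonneg (mul_nonneg hs (hw i)) (mul_nonneg ht (hu i))
      · simp [hwS i hi, huS i hi]
      · rw [Finset.sum_add_distrib, ← Finset.mul_sum, ← Finset.mul_sum, hw1, hu1]
        simpa using hst
      · simp only [add_smul, mul_smul, Finset.sum_add_distrib, Finset.smul_sum]
  · rintro ⟨w, hw, hwS, hw1, rfl⟩
    have hne : ∀ i, w i ≠ 0 → i ∈ S := fun i hi => by_contra fun h => hi (hwS i h)
    have h1 : ∑ i with w i ≠ 0, w i = 1 := by rw [Finset.sum_filter_ne_zero, hw1]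
    have h2 : ∑ i with w i ≠ 0, w i • p i = ∑ i, w i • p i := by
      refine Finset.sum_filter_of_ne fun i _ hi h => hi ?_
      simp [h]
    rw [← h2]
    refine (convex_convexHull ℝ _).sum_mem (fun i _ => hw i) h1 fun i hi => ?_
    exact subset_convexHull ℝ _ ⟨i, hne i (Finset.mem_filter.1 hi).2, rfl⟩

theorem mem_convexHull_range_iff_exists_weights [Fintype ι] {p : ι → E} {x : E} :
    x ∈ convexHull ℝ (Set.range p) ↔ ∃ w : ι → ℝ, (∀ i, 0 ≤ w i) ∧
      ∑ i, w i = 1 ∧ ∑ i, w i • p i = x := by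
  rw [← Set.image_univ, mem_convexHull_image_iff_exists_weights]
  simp

/-- A point of a polytope at which a linear functional attains its minimum lies in the convex hull
of the generators at which the minimum is attained. -/
theorem mem_convexHull_image_of_apply_le [Fintype ι] {p : ι → E} {x : E} (φ : E →ₗ[ℝ] ℝ) {μ : ℝ}
    (hμ : ∀ i, μ ≤ φ (p i)) (hx : x ∈ convexHull ℝ (Set.range p)) (hxμ : φ x ≤ μ) :
    x ∈ convexHull ℝ (p '' {i | φ (p i) = μ}) := by
  obtain ⟨w, hw, hw1, rfl⟩ := mem_convexHull_range_iff_exists_weights.1 hx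
  refine mem_convexHull_image_iff_exists_weights.2 ⟨w, hw, fun i hi => ?_, hw1, rfl⟩
  have hnn : ∀ i ∈ Finset.univ, 0 ≤ w i * (φ (p i) - μ) :=
    fun i _ => mul_nonneg (hw i) (sub_nonneg.2 (hμ i))
  have hsum : ∑ i, w i * (φ (p i) - μ) = 0 := by
    refine le_antisymm ?_ (Finset.sum_nonneg hnn)
    simp only [mul_sub, Finset.sum_sub_distrib, ← Finset.sum_mul, hw1]
    simpa using hxμ
  have h0 := (Finset.sum_eq_zero_iff_of_nonneg hnn).1 hsum i (Finset.mem_univ i)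
  exact (mul_eq_zero.1 h0).resolve_right fun h => hi (sub_eq_zero.1 h)

end ConvexHull

/-! ### Cells and covering property of regular subdivisions -/

section RegularSubdivision

variable {ι κ E : Type*} [NormedAddCommGroup E] [NormedSpace ℝ E]

theorem mem_extendedPolyhedron {p : ι → E} {h : ι → ℝ} {z : E × ℝ} :
    z ∈ extendedPolyhedron p h ↔
      ∃ q ∈ convexHull ℝ (Set.range fun i => (p i, h i)), q.1 = z.1 ∧ q.2 ≤ z.2 := by
  constructor
  · rintro ⟨q, hq, r, ⟨hr1, hr2⟩, rfl⟩
    exact ⟨q, hq, by simp [hr1], by simpa using hr2⟩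
  · rintro ⟨q, hq, h1, h2⟩
    refine ⟨q, hq, (0, z.2 - q.2), ⟨rfl, sub_nonneg.2 h2⟩, ?_⟩
    ext <;> simp [h1]

theorem extendedPolyhedron_mono {p : ι → E} {h : ι → ℝ} {p' : κ → E} {h' : κ → ℝ}
    (H : ∀ i, ∃ j, p' j = p i ∧ h' j ≤ h i) :
    extendedPolyhedron p h ⊆ extendedPolyhedron p' h' := by
  have hconv : Convex ℝ (extendedPolyhedron p' h') := by
    refine (convex_convexHull ℝ _).add ?_
    rintro x ⟨hx1, hx2⟩ y ⟨hy1, hy2⟩ s t hs ht _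
    refine ⟨by simp [hx1, hy1], ?_⟩
    exact add_nonneg (mul_nonneg hs hx2) (mul_nonneg ht hy2)
  have hsub : convexHull ℝ (Set.range fun i => (p i, h i)) ⊆ extendedPolyhedron p' h' := by
    refine convexHull_min ?_ hconv
    rintro _ ⟨i, rfl⟩
    obtain ⟨j, hj1, hj2⟩ := H i
    exact mem_extendedPolyhedron.2 ⟨(p' j, h' j), subset_convexHull ℝ _ ⟨j, rfl⟩, hj1, hj2⟩
  intro z hz
  obtain ⟨q, hq, hq1, hq2⟩ := mem_extendedPolyhedron.1 hz
  obtain ⟨r, hr, hr1, hr2⟩ := mem_extendedPolyhedron.1 (hsub hq)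
  exact mem_extendedPolyhedron.2 ⟨r, hr, hr1.trans hq1, hr2.trans hq2⟩

/-- Points that are lifted higher than another copy of the same point do not matter. -/
theorem regularSubdivision_congr {p : ι → E} {h : ι → ℝ} {p' : κ → E} {h' : κ → ℝ}
    (H : ∀ i, ∃ j, p' j = p i ∧ h' j ≤ h i) (H' : ∀ j, ∃ i, p i = p' j ∧ h i ≤ h' j) :
    regularSubdivision p h = regularSubdivision p' h' := by
  unfold regularSubdivision
  rw [(extendedPolyhedron_mono H).antisymm (extendedPolyhedron_mono H')]

/-- The functional `z.2 - a z.1` strictly increases along the upward ray, so its minimisers on the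
polyhedron already lie in the convex hull of the lifted points, and there only minimising vertices
carry weight. -/
theorem convexHull_lift_lowerContact [Finite ι] (p : ι → E) (h : ι → ℝ) (a : StrongDual ℝ E) :
    convexHull ℝ ((fun i => (p i, h i)) '' lowerContact p h a) =
      {z ∈ extendedPolyhedron p h |
        ∀ y ∈ extendedPolyhedron p h, a y.1 - y.2 ≤ a z.1 - z.2} := by
  have := Fintype.ofFinite ι
  let φ : E × ℝ →ₗ[ℝ] ℝ := LinearMap.snd ℝ E ℝ - a.toLinearMap ∘ₗ LinearMap.fst ℝ E ℝ
  have hφ : ∀ z, φ z = z.2 - a z.1 := fun z => rfl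
  have hbound : ∀ μ, (∀ i, μ ≤ h i - a (p i)) → ∀ y ∈ extendedPolyhedron p h, μ ≤ φ y := by
    intro μ hμ y hy
    obtain ⟨q, hq, hq1, hq2⟩ := mem_extendedPolyhedron.1 hy
    have : μ ≤ φ q := by
      refine convexHull_min (t := {q | μ ≤ φ q}) ?_ (convex_halfSpace_ge φ.isLinear μ) hq
      rintro _ ⟨i, rfl⟩
      exact hμ i
    rw [hφ] at this ⊢
    rw [← hq1]
    linarith
  have hmem : ∀ i, (p i, h i) ∈ extendedPolyhedron p h := fun i =>
    mem_extendedPolyhedron.2 ⟨(p i, h i), subset_convexHull ℝ _ ⟨i, rfl⟩, rfl, le_rfl⟩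
  ext z
  constructor
  · intro hz
    refine ⟨mem_extendedPolyhedron.2 ⟨z, convexHull_mono (Set.image_subset_range _ _) hz,
      rfl, le_rfl⟩, fun y hy => ?_⟩
    have : φ z ≤ φ y := by
      refine convexHull_min (t := {q | φ q ≤ φ y}) ?_ (convex_halfSpace_le φ.isLinear _) hz
      rintro _ ⟨i, hi, rfl⟩
      exact hbound _ hi y hy
    rw [hφ, hφ] at this
    linarith
  · rintro ⟨hz, hmin⟩
    obtain ⟨q, hq, hq1, hq2⟩ := mem_extendedPolyhedron.1 hz
    have hqU : q ∈ extendedPolyhedron p h := mem_extendedPolyhedron.2 ⟨q, hq, rfl, le_rfl⟩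
    have h1 := hmin q hqU
    rw [hq1] at h1
    have hqz : q = z := Prod.ext hq1 (by linarith)
    subst hqz
    have hle : ∀ i, φ q ≤ φ (p i, h i) := fun i => by
      have := hmin _ (hmem i)
      rw [hφ, hφ]
      linarith
    refine convexHull_mono (Set.image_mono ?_)
      (mem_convexHull_image_of_apply_le φ hle hq le_rfl)
    intro i (hi : φ (p i, h i) = φ q) j
    have := (hi.trans_le (hle j))
    rwa [hφ, hφ] at this

/-- The cells of a regular subdivision are the convex hulls of the sets of points whose lifts lie on
a common non-vertical supporting hyperplane. -/
theorem mem_regularSubdivision_iff [Finite ι] {p : ι → E} {h : ι → ℝ} {C : Set E} :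
    C ∈ regularSubdivision p h ↔
      C = ∅ ∨ ∃ a : StrongDual ℝ E, C = convexHull ℝ (p '' lowerContact p h a) := by
  have himage : ∀ a : StrongDual ℝ E,
      Prod.fst '' convexHull ℝ ((fun i => (p i, h i)) '' lowerContact p h a) =
        convexHull ℝ (p '' lowerContact p h a) := by
    intro a
    have := (LinearMap.fst ℝ E ℝ).image_convexHull
      ((fun i => (p i, h i)) '' lowerContact p h a)
    rw [Set.image_image] at this
    exact this
  constructor
  · rintro ⟨F, hF, hb, rfl⟩
    obtain rfl | hne := F.eq_empty_or_nonempty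
    · simp
    refine Or.inr ?_
    obtain ⟨l, rfl⟩ := hF hne
    obtain ⟨z, hz, hzmax⟩ := hne
    have hup : ∀ t : ℝ, 0 ≤ t → z + (0, t) ∈ extendedPolyhedron p h := by
      intro t ht
      obtain ⟨q, hq, hq1, hq2⟩ := mem_extendedPolyhedron.1 hz
      exact mem_extendedPolyhedron.2 ⟨q, hq, by simp [hq1], by simp; linarith⟩
    have hlt : ∀ t : ℝ, l ((0 : E), t) = t * l (0, 1) := by
      intro t
      have : ((0 : E), t) = t • ((0 : E), (1 : ℝ)) := by simp
      rw [this, map_smul, smul_eq_mul]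
    -- If `l` vanished on the vertical direction, the face would contain an upward ray and be
    -- unbounded. Hence `l` can be rescaled to the form `a y.1 - y.2`.
    have hc : l (0, 1) < 0 := by
      have h1 := hzmax _ (hup 1 zero_le_one)
      rw [map_add] at h1
      refine lt_of_le_of_ne (by linarith) fun h0 => ?_
      obtain ⟨R, hR⟩ := hb.exists_norm_le
      have hmem : z + (0, |R| + ‖z‖ + 1) ∈
          {x ∈ extendedPolyhedron p h | ∀ y ∈ extendedPolyhedron p h, l y ≤ l x} := by
        refine ⟨hup _ (by positivity), fun y hy => ?_⟩
        rw [map_add, hlt, h0, mul_zero, add_zero]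
        exact hzmax y hy
      have h2 := (norm_snd_le _).trans (hR _ hmem)
      have h3 := norm_snd_le z
      simp only [Prod.snd_add, Real.norm_eq_abs] at h2 h3
      have := le_abs_self (z.2 + (|R| + ‖z‖ + 1))
      have := neg_abs_le z.2
      have := le_abs_self R
      linarith
    let a : StrongDual ℝ E := (-(l (0, 1)))⁻¹ • l.comp (ContinuousLinearMap.inl ℝ E ℝ)
    refine ⟨a, ?_⟩
    rw [← himage, convexHull_lift_lowerContact]
    have hla : ∀ y : E × ℝ, l y = -(l (0, 1)) * (a y.1 - y.2) := by
      intro y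
      have hy : l y = l (y.1, 0) + y.2 * l (0, 1) := by
        rw [← hlt, ← map_add]
        simp
      have ha : a y.1 = (-(l (0, 1)))⁻¹ * l (y.1, 0) := rfl
      have hc' := hc.ne
      rw [hy, ha]
      field_simp
      ring
    congr 1
    ext y
    refine and_congr_right fun _ => forall₂_congr fun y' _ => ?_
    rw [hla y', hla y]
    exact mul_le_mul_iff_right₀ (by linarith)
  · rintro (rfl | ⟨a, rfl⟩)
    · exact ⟨∅, isExposed_empty, Bornology.isBounded_empty, by simp⟩
    · refine ⟨_, fun _ => ⟨a.comp (ContinuousLinearMap.fst ℝ E ℝ) - ContinuousLinearMap.snd ℝ E ℝ,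
        convexHull_lift_lowerContact p h a⟩, ?_, (himage a).symm⟩
      exact (Set.Finite.isCompact_convexHull ℝ (Set.toFinite _)).isBounded

theorem isClosed_sUnion_regularSubdivision [Finite ι] (p : ι → E) (h : ι → ℝ) :
    IsClosed (⋃₀ regularSubdivision p h) := by
  have hsub : regularSubdivision p h ⊆
      insert ∅ (Set.range fun S : Set ι => convexHull ℝ (p '' S)) := by
    intro C hC
    rcases mem_regularSubdivision_iff.1 hC with rfl | ⟨a, rfl⟩
    · exact Set.mem_insert _ _
    · exact Set.mem_insert_of_mem _ ⟨_, rfl⟩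
  rw [Set.sUnion_eq_biUnion]
  refine (((Set.finite_range _).insert _).subset hsub).isClosed_biUnion fun C hC => ?_
  rcases hsub hC with rfl | ⟨S, rfl⟩
  · exact isClosed_empty
  · exact (Set.toFinite _).isClosed_convexHull ℝ

/-- A convex combination with positive weights is covered by a cell: minimise the weighted slack
over all affine functions below the height function. -/
theorem exists_mem_convexHull_lowerContact [Fintype ι] [Nonempty ι] (p : ι → E) (h : ι → ℝ)
    {w : ι → ℝ} (hw : ∀ i, 0 < w i) (hw1 : ∑ i, w i = 1) :
    ∃ a : StrongDual ℝ E, ∑ i, w i • p i ∈ convexHull ℝ (p '' lowerContact p h a) := by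
  set x := ∑ i, w i • p i with hx
  let T : StrongDual ℝ E × ℝ →ₗ[ℝ] ι → ℝ :=
    { toFun := fun ac i => ac.1 (p i) + ac.2
      map_add' := fun _ _ => by ext; simp; ring
      map_smul' := fun _ _ => by ext; simp; ring }
  have hT : ∀ a c i, T (a, c) i = a (p i) + c := fun _ _ _ => rfl
  -- `K` is the set of slack vectors `s = h - (affine function on the points)` with `s ≥ 0`. Working
  -- with slacks avoids the non-uniqueness of the affine function and the possibly infinite
  -- dimension of `E`.
  let K : Set (ι → ℝ) := {s | 0 ≤ s ∧ h - s ∈ LinearMap.range T}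
  let φ : (ι → ℝ) → ℝ := fun s => ∑ i, w i * s i
  have hφ : Continuous φ := by fun_prop
  have hK : IsClosed K := by
    refine isClosed_Ici.inter ?_
    exact (LinearMap.range T).closed_of_finiteDimensional.preimage (continuous_const.sub continuous_id)
  obtain ⟨i₀, hi₀⟩ := Finite.exists_min h
  have hs₀ : (fun i => h i - h i₀) ∈ K := by
    refine ⟨fun i => sub_nonneg.2 (hi₀ i), (0, h i₀), ?_⟩
    ext i
    simp [hT]
  set M := φ fun i => h i - h i₀
  -- Positivity of all weights bounds each slack by `M / w i`; this is what makes the minimum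
  -- attained.
  have hcomp : IsCompact (K ∩ {s | φ s ≤ M}) := by
    refine IsCompact.of_isClosed_subset (isCompact_Icc (a := (0 : ι → ℝ)) (b := fun i => M / w i))
      (hK.inter (isClosed_le hφ continuous_const)) ?_
    rintro s ⟨⟨hs, -⟩, hsM⟩
    refine ⟨hs, fun i => ?_⟩
    rw [le_div_iff₀ (hw i), mul_comm]
    exact (Finset.single_le_sum (f := fun i => w i * s i)
      (fun j _ => mul_nonneg (hw j).le (hs j)) (Finset.mem_univ i)).trans hsM
  obtain ⟨s, ⟨⟨hs, ⟨a, c⟩, hac⟩, hsM⟩, hmin⟩ :=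
    hcomp.exists_isMinOn ⟨_, hs₀, le_refl M⟩ hφ.continuousOn
  have hsi : ∀ i, s i = h i - a (p i) - c := fun i => by
    have := congrFun hac i
    rw [hT, Pi.sub_apply] at this
    linarith
  refine ⟨a, ?_⟩
  suffices hmem : x ∈ convexHull ℝ (p '' {i | s i = 0}) by
    refine convexHull_mono (Set.image_mono ?_) hmem
    intro i hi j
    have h1 := hsi i
    have h2 := hsi j
    have h3 : 0 ≤ s j := hs j
    have h4 : s i = 0 := hi
    linarith
  -- Otherwise a functional `b` separates `x` from the contact points. Adding `ε * (b - u)` to the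
  -- slack keeps it nonnegative for small `ε` but changes its weighted sum by `ε * (b x - u) < 0`.
  by_contra hnot
  obtain ⟨b, u, hbx, hbu⟩ := geometric_hahn_banach_point_closed (convex_convexHull ℝ _)
    ((Set.toFinite (p '' {i | s i = 0})).isClosed_convexHull ℝ) hnot
  have hpos : ∀ᶠ ε : ℝ in nhdsWithin 0 (Set.Ioi 0), ∀ i, 0 ≤ s i + ε * (b (p i) - u) := by
    refine Filter.eventually_all.2 fun i => ?_
    rcases (hs i).eq_or_lt with h0 | h0
    · have hb : u < b (p i) := hbu _ (subset_convexHull ℝ _ ⟨i, h0.symm, rfl⟩)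
      filter_upwards [self_mem_nhdsWithin] with ε hε
      rw [← h0]
      have : 0 ≤ ε * (b (p i) - u) := mul_nonneg (le_of_lt hε) (by linarith)
      simpa using this
    · have hcont : Continuous fun ε : ℝ => s i + ε * (b (p i) - u) := by fun_prop
      have hlt : ∀ᶠ ε in nhds (0 : ℝ), 0 < s i + ε * (b (p i) - u) :=
        hcont.continuousAt.eventually_const_lt (by simpa using h0)
      exact (hlt.filter_mono nhdsWithin_le_nhds).mono fun _ h => h.le
  obtain ⟨ε, hε, hε0⟩ := (hpos.and self_mem_nhdsWithin).exists
  replace hε0 : 0 < ε := hε0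
  have hK' : (fun i => s i + ε * (b (p i) - u)) ∈ K := by
    refine ⟨hε, (a - ε • b, c + ε * u), ?_⟩
    ext i
    simp [hT, hsi]
    ring
  have hbx' : ∑ i, w i * b (p i) = b x := by simp [hx, map_sum]
  have hlt : φ (fun i => s i + ε * (b (p i) - u)) < φ s := by
    have : φ (fun i => s i + ε * (b (p i) - u)) = φ s + ε * (b x - u) := by
      simp only [φ, ← hbx']
      calc ∑ i, w i * (s i + ε * (b (p i) - u))
          = ∑ i, (w i * s i + ε * (w i * b (p i)) - ε * u * w i) :=
            Finset.sum_congr rfl fun i _ => by ring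
        _ = _ := by
            rw [Finset.sum_sub_distrib, Finset.sum_add_distrib, ← Finset.mul_sum, ← Finset.mul_sum,
              hw1]
            ring
    rw [this]
    nlinarith
  exact absurd (hmin ⟨hK', hlt.le.trans hsM⟩) (not_le.2 hlt)

/-- A regular subdivision covers the convex hull of its point configuration. -/
theorem sUnion_regularSubdivision [Finite ι] (p : ι → E) (h : ι → ℝ) :
    ⋃₀ regularSubdivision p h = convexHull ℝ (Set.range p) := by
  have := Fintype.ofFinite ι
  apply subset_antisymm
  · refine Set.sUnion_subset fun C hC => ?_
    rcases mem_regularSubdivision_iff.1 hC with rfl | ⟨a, rfl⟩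
    · exact Set.empty_subset _
    · exact convexHull_mono (Set.image_subset_range _ _)
  · intro x hx
    have hne : Nonempty ι := Set.range_nonempty_iff_nonempty.1 (convexHull_nonempty_iff.1 ⟨x, hx⟩)
    obtain ⟨w, hw, hw1, rfl⟩ := mem_convexHull_range_iff_exists_weights.1 hx
    let N : ℝ := Fintype.card ι
    have hN : 0 < N := Nat.cast_pos.2 Fintype.card_pos
    -- Some weights may vanish, so `x` is approached by combinations mixed with the uniform weights,
    -- which are positive; the union of the cells is closed.
    let γ : ℝ → E := fun t => ∑ i, ((1 - t) * w i + t * N⁻¹) • p i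
    have hγ : Continuous γ := by fun_prop
    have hlim : Filter.Tendsto γ (nhdsWithin 0 (Set.Ioo 0 1)) (nhds (γ 0)) :=
      hγ.continuousAt.tendsto.mono_left nhdsWithin_le_nhds
    have h0 : γ 0 = ∑ i, w i • p i := by simp [γ]
    rw [← h0]
    have : (nhdsWithin (0 : ℝ) (Set.Ioo 0 1)).NeBot := by
      rw [← mem_closure_iff_nhdsWithin_neBot, closure_Ioo zero_ne_one]
      simp
    refine (isClosed_sUnion_regularSubdivision p h).mem_of_tendsto hlim ?_
    filter_upwards [self_mem_nhdsWithin] with t ht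
    obtain ⟨a, ha⟩ := exists_mem_convexHull_lowerContact p h
      (w := fun i => (1 - t) * w i + t * N⁻¹)
      (fun i => add_pos_of_nonneg_of_pos (mul_nonneg (by linarith [ht.2]) (hw i))
        (mul_pos ht.1 (inv_pos.2 hN)))
      (by
        rw [Finset.sum_add_distrib, ← Finset.mul_sum, hw1, Finset.sum_const, Finset.card_univ,
          nsmul_eq_mul]
        have : N * (t * N⁻¹) = t := by field_simp
        change (1 - t) * 1 + N * (t * N⁻¹) = 1
        rw [this]; ring)
    exact ⟨_, mem_regularSubdivision_iff.2 (Or.inr ⟨a, rfl⟩), ha⟩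

end RegularSubdivision

/-! ### Expansion of the tropical product -/

section TropicalProduct

variable {d n : ℕ}

theorem prod_tropicalLinearForm (V : Matrix (Fin d) (Fin n) (WithTop ℝ)) :
    ∏ k, tropicalLinearForm (fun i => V i k) = ∑ σ : Fin n → Fin d,
      MvPolynomial.monomial (∑ k, Finsupp.single (σ k) 1)
        (Tropical.trop (∑ k, V (σ k) k)) := by
  simp only [tropicalLinearForm, Finset.prod_univ_sum, Fintype.piFinset_univ]
  refine Finset.sum_congr rfl fun σ _ => ?_
  rw [Finset.prod_mul_distrib, ← map_prod, MvPolynomial.monomial_sum_index, trop_sum]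
  rfl

theorem untrop_coeff_prod_tropicalLinearForm (V : Matrix (Fin d) (Fin n) (WithTop ℝ))
    (m : Fin d →₀ ℕ) :
    Tropical.untrop ((∏ k, tropicalLinearForm fun i => V i k).coeff m) =
      (Finset.univ.filter fun σ : Fin n → Fin d => ∑ k, Finsupp.single (σ k) 1 = m).inf
        fun σ => ∑ k, V (σ k) k := by
  rw [prod_tropicalLinearForm, MvPolynomial.coeff_sum]
  simp only [MvPolynomial.coeff_monomial]
  rw [← Finset.sum_filter, Finset.untrop_sum']
  rfl

/-- The subdivision of a tropical product of linear forms, described by the Minkowski sum of `n`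
copies of the vertices of the simplex. -/
theorem matrixSubdivision_eq_regularSubdivision (V : Matrix (Fin d) (Fin n) ℝ) :
    matrixSubdivision (V.map ((↑) : ℝ → WithTop ℝ)) =
      regularSubdivision
        (fun σ : Fin n → Fin d => ∑ k, (Pi.single (σ k) 1 : Fin d → ℝ))
        (fun σ => ∑ k, V (σ k) k) := by
  set F := ∏ k : Fin n, tropicalLinearForm fun i => V.map ((↑) : ℝ → WithTop ℝ) i k with hF
  have hcoe : ∀ σ : Fin n → Fin d, ∑ k, V.map ((↑) : ℝ → WithTop ℝ) (σ k) k =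
      ((∑ k, V (σ k) k : ℝ) : WithTop ℝ) := fun σ => by simp
  have hexp : ∀ σ : Fin n → Fin d,
      (fun i => (((∑ k, Finsupp.single (σ k) 1 : Fin d →₀ ℕ) i : ℕ) : ℝ)) =
        ∑ k, (Pi.single (σ k) 1 : Fin d → ℝ) := by
    intro σ
    ext i
    simp [Finsupp.single_apply, Pi.single_apply, eq_comm, Finsupp.finsetSum_apply]
  have hsupp : ∀ m, m ∈ F.support ↔ Tropical.untrop (F.coeff m) ≠ ⊤ := fun m => by
    rw [MvPolynomial.mem_support_iff, ← Tropical.untrop_zero, Tropical.untrop_injective.ne_iff]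
  -- Several `σ` may give the same exponent; its coefficient is the least of their heights, and the
  -- higher copies are irrelevant.
  refine regularSubdivision_congr ?_ ?_
  · rintro ⟨m, hm⟩
    have hm' := (hsupp m).1 hm
    rw [hF, untrop_coeff_prod_tropicalLinearForm] at hm'
    have hne : (Finset.univ.filter fun σ : Fin n → Fin d =>
        ∑ k, Finsupp.single (σ k) 1 = m).Nonempty := by
      rw [Finset.nonempty_iff_ne_empty]
      intro h
      rw [h] at hm'
      exact hm' rfl
    obtain ⟨σ, hσ, hinf⟩ := Finset.exists_mem_eq_inf _ hne
      fun σ : Fin n → Fin d => ∑ k, V.map ((↑) : ℝ → WithTop ℝ) (σ k) k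
    have hσm := (Finset.mem_filter.1 hσ).2
    refine ⟨σ, ?_, ?_⟩
    · rw [← hexp, hσm]
    · change _ ≤ (Tropical.untrop (F.coeff m)).untopD 0
      rw [hF, untrop_coeff_prod_tropicalLinearForm, hinf, hcoe]
      exact le_rfl
  · intro σ
    have hle : Tropical.untrop (F.coeff (∑ k, Finsupp.single (σ k) 1)) ≤
        ((∑ k, V (σ k) k : ℝ) : WithTop ℝ) := by
      rw [hF, untrop_coeff_prod_tropicalLinearForm, ← hcoe]
      exact Finset.inf_le (f := fun σ : Fin n → Fin d =>
        ∑ k, V.map ((↑) : ℝ → WithTop ℝ) (σ k) k) (by simp)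
    refine ⟨⟨_, (hsupp _).2 (ne_top_of_le_ne_top (WithTop.coe_ne_top) hle)⟩, hexp σ, ?_⟩
    exact WithTop.untopD_le hle

end TropicalProduct

/-! ### Mixed cells and the Cayley trick for one cell -/

section MixedCells

variable {d n : ℕ}

/-- The vertices `i` of the simplex at which `V i k - a eᵢ` is minimal. -/
def columnContact (V : Matrix (Fin d) (Fin n) ℝ) (a : StrongDual ℝ (Fin d → ℝ)) (k : Fin n) :
    Set (Fin d) :=
  lowerContact (fun i => (Pi.single i 1 : Fin d → ℝ)) (fun i => V i k) a

/-- The objective is separable over the columns: changing `σ` at a single `k` compares only the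
terms of that column. -/
theorem mem_lowerContact_sum_iff {V : Matrix (Fin d) (Fin n) ℝ} {a : StrongDual ℝ (Fin d → ℝ)}
    {σ : Fin n → Fin d} :
    σ ∈ lowerContact (fun σ : Fin n → Fin d => ∑ k, (Pi.single (σ k) 1 : Fin d → ℝ))
        (fun σ => ∑ k, V (σ k) k) a ↔ ∀ k, σ k ∈ columnContact V a k := by
  simp only [lowerContact, columnContact, Set.mem_ofPred_eq, map_sum, ← Finset.sum_sub_distrib]
  constructor
  · intro h k j
    have := h (Function.update σ k j)
    rw [← Finset.add_sum_erase _ _ (Finset.mem_univ k),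
      ← Finset.add_sum_erase (a := k) _ _ (Finset.mem_univ k)] at this
    have hrest : ∑ x ∈ Finset.univ.erase k, (V (Function.update σ k j x) x -
        a (Pi.single (Function.update σ k j x) 1)) =
          ∑ x ∈ Finset.univ.erase k, (V (σ x) x - a (Pi.single (σ x) 1)) :=
      Finset.sum_congr rfl fun x hx => by
        rw [Function.update_of_ne (Finset.ne_of_mem_erase hx)]
    rw [hrest, Function.update_self] at this
    exact le_of_add_le_add_right this
  · intro h τ
    exact Finset.sum_le_sum fun k _ => h k (τ k)

theorem mem_matrixSubdivision_iff {V : Matrix (Fin d) (Fin n) ℝ} {C : Set (Fin d → ℝ)} :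
    C ∈ matrixSubdivision (V.map ((↑) : ℝ → WithTop ℝ)) ↔
      C = ∅ ∨ ∃ a : StrongDual ℝ (Fin d → ℝ),
        C = convexHull ℝ (∑ k, (fun i => (Pi.single i 1 : Fin d → ℝ)) '' columnContact V a k) := by
  rw [matrixSubdivision_eq_regularSubdivision, mem_regularSubdivision_iff]
  refine or_congr_right (exists_congr fun a => ?_)
  suffices h : (fun σ : Fin n → Fin d => ∑ k, (Pi.single (σ k) 1 : Fin d → ℝ)) ''
      lowerContact (fun σ : Fin n → Fin d => ∑ k, (Pi.single (σ k) 1 : Fin d → ℝ))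
        (fun σ => ∑ k, V (σ k) k) a =
      ∑ k, (fun i => (Pi.single i 1 : Fin d → ℝ)) '' columnContact V a k by rw [h]
  ext x
  rw [Set.mem_fintype_sum]
  constructor
  · rintro ⟨σ, hσ, rfl⟩
    exact ⟨fun k => Pi.single (σ k) 1, fun k => ⟨σ k, mem_lowerContact_sum_iff.1 hσ k, rfl⟩, rfl⟩
  · rintro ⟨g, hg, rfl⟩
    choose σ hσ hσg using fun k => hg k
    exact ⟨σ, mem_lowerContact_sum_iff.2 hσ, Finset.sum_congr rfl fun k _ => hσg k⟩

theorem sum_stdSimplex_eq_smul (hn : 1 ≤ n) :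
    ∑ _k : Fin n, stdSimplex ℝ (Fin d) = (n : ℝ) • stdSimplex ℝ (Fin d) := by
  have hn0 : (n : ℝ) ≠ 0 := by positivity
  ext x
  rw [Set.mem_fintype_sum]
  constructor
  · rintro ⟨g, hg, rfl⟩
    refine ⟨∑ k, (n : ℝ)⁻¹ • g k, ?_, ?_⟩
    · exact (convex_stdSimplex ℝ _).sum_mem (fun _ _ => by positivity) (by simp [hn0])
        fun k _ => hg k
    · simp [← Finset.smul_sum, smul_smul, hn0]
  · rintro ⟨y, hy, rfl⟩
    exact ⟨fun _ => y, fun _ => hy, by simp [Nat.cast_smul_eq_nsmul]⟩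

theorem mem_convexHull_single_image_iff {S : Set (Fin d)} {u : Fin d → ℝ} :
    u ∈ convexHull ℝ ((fun i => (Pi.single i 1 : Fin d → ℝ)) '' S) ↔
      (∀ i, 0 ≤ u i) ∧ (∀ i ∉ S, u i = 0) ∧ ∑ i, u i = 1 := by
  have hu : ∀ w : Fin d → ℝ, ∑ i, w i • (Pi.single i 1 : Fin d → ℝ) = w := fun w => by
    ext j
    simp [Finset.sum_apply, Pi.single_apply]
  rw [mem_convexHull_image_iff_exists_weights]
  constructor
  · rintro ⟨w, h1, h2, h3, h4⟩
    rw [hu] at h4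
    subst h4
    exact ⟨h1, h2, h3⟩
  · rintro ⟨h1, h2, h3⟩
    exact ⟨u, h1, h2, h3, hu u⟩

/-- The Cayley trick for a single cell: the barycentric slice of a subpolytope of a product of
simplices is a scaled mixed cell. -/
theorem convexHull_prod_inter_barycentricSubspace (hn : 1 ≤ n) (S : Fin n → Set (Fin d)) :
    convexHull ℝ ((fun ik : Fin d × Fin n =>
        ((Pi.single ik.1 1 : Fin d → ℝ), (Pi.single ik.2 1 : Fin n → ℝ))) ''
          {ik | ik.1 ∈ S ik.2}) ∩ (barycentricSubspace d n : Set ((Fin d → ℝ) × (Fin n → ℝ))) =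
      (fun x => ((n : ℝ)⁻¹ • x, fun _ => (1 : ℝ) / n)) ''
        convexHull ℝ (∑ k, (fun i => (Pi.single i 1 : Fin d → ℝ)) '' S k) := by
  have hn0 : (n : ℝ) ≠ 0 := by positivity
  have hfst : ∀ w : Fin d × Fin n → ℝ, (∑ ik, w ik •
      ((Pi.single ik.1 1 : Fin d → ℝ), (Pi.single ik.2 1 : Fin n → ℝ))).1 =
        ∑ k, fun i => w (i, k) := by
    intro w
    ext j
    simp [Prod.fst_sum, Finset.sum_apply, Fintype.sum_prod_type_right, Pi.single_apply]
  have hsnd : ∀ (w : Fin d × Fin n → ℝ) k, (∑ ik, w ik •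
      ((Pi.single ik.1 1 : Fin d → ℝ), (Pi.single ik.2 1 : Fin n → ℝ))).2 k =
        ∑ i, w (i, k) := by
    intro w k
    simp [Prod.snd_sum, Finset.sum_apply, Fintype.sum_prod_type, Pi.single_apply]
  rw [convexHull_sum]
  ext z
  constructor
  · rintro ⟨hz, hzL⟩
    obtain ⟨w, hw, hwS, hw1, rfl⟩ := mem_convexHull_image_iff_exists_weights.1 hz
    replace hzL : (∑ ik, w ik •
      ((Pi.single ik.1 1 : Fin d → ℝ), (Pi.single ik.2 1 : Fin n → ℝ))).2 = fun _ => (1 : ℝ) / n :=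
      hzL
    -- On the slice the weights in column `k` sum to `1/n`, so `n` times that column is a point of
    -- the simplex supported on `S k`.
    refine ⟨∑ k, fun i => (n : ℝ) * w (i, k), ?_, ?_⟩
    · refine (Set.mem_fintype_sum _ _).2 ⟨fun k i => (n : ℝ) * w (i, k), fun k => ?_, rfl⟩
      refine mem_convexHull_single_image_iff.2 ⟨fun i => by have := hw (i, k); positivity,
        fun i hi => by simp [hwS (i, k) hi], ?_⟩
      rw [← Finset.mul_sum, ← hsnd, hzL]
      field_simp
    · refine Prod.ext ?_ hzL.symm
      rw [hfst]
      ext i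
      simp [Finset.sum_apply, ← Finset.mul_sum, hn0]
  · rintro ⟨x, hx, rfl⟩
    obtain ⟨u, hu, rfl⟩ := (Set.mem_fintype_sum _ _).1 hx
    replace hu := fun k => mem_convexHull_single_image_iff.1 (hu k)
    refine ⟨mem_convexHull_image_iff_exists_weights.2
      ⟨fun ik => (n : ℝ)⁻¹ * u ik.2 ik.1, fun ik => ?_, fun ik hik => ?_, ?_, ?_⟩, rfl⟩
    · have := (hu ik.2).1 ik.1
      positivity
    · simp [(hu ik.2).2.1 ik.1 hik]
    · simp [Fintype.sum_prod_type_right, ← Finset.mul_sum, (hu _).2.2, hn0]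
    · refine Prod.ext ?_ ?_
      · rw [hfst]
        ext i
        simp [Finset.sum_apply, Finset.mul_sum]
      · ext k
        rw [hsnd]
        simp [← Finset.mul_sum, (hu _).2.2]

end MixedCells

/-! ### Matching mixed cells with slices of cells of the product -/

section CayleyTrick

variable {d n : ℕ}

theorem mem_productSubdivision_iff {V : Matrix (Fin d) (Fin n) ℝ}
    {C : Set ((Fin d → ℝ) × (Fin n → ℝ))} :
    C ∈ productSubdivision V ↔ C = ∅ ∨ ∃ l : StrongDual ℝ ((Fin d → ℝ) × (Fin n → ℝ)),
      C = convexHull ℝ ((fun ik : Fin d × Fin n =>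
        ((Pi.single ik.1 1 : Fin d → ℝ), (Pi.single ik.2 1 : Fin n → ℝ))) ''
          lowerContact (fun ik : Fin d × Fin n =>
            ((Pi.single ik.1 1 : Fin d → ℝ), (Pi.single ik.2 1 : Fin n → ℝ)))
            (fun ik => V ik.1 ik.2) l) :=
  mem_regularSubdivision_iff

/-- If the contact set of a functional on the product of simplices meets every column, it is
determined by the restriction of the functional to the first factor. -/
theorem lowerContact_prod_eq {V : Matrix (Fin d) (Fin n) ℝ}
    {l : StrongDual ℝ ((Fin d → ℝ) × (Fin n → ℝ))}
    (hl : ∀ k, ∃ i, (i, k) ∈ lowerContact (fun ik : Fin d × Fin n =>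
      ((Pi.single ik.1 1 : Fin d → ℝ), (Pi.single ik.2 1 : Fin n → ℝ)))
      (fun ik => V ik.1 ik.2) l) :
    lowerContact (fun ik : Fin d × Fin n =>
      ((Pi.single ik.1 1 : Fin d → ℝ), (Pi.single ik.2 1 : Fin n → ℝ)))
      (fun ik => V ik.1 ik.2) l =
    {ik | ik.1 ∈ columnContact V (l.comp (ContinuousLinearMap.inl ℝ _ _)) ik.2} := by
  have hsplit : ∀ (i : Fin d) (k : Fin n), l (Pi.single i 1, Pi.single k 1) =
      l.comp (ContinuousLinearMap.inl ℝ _ _) (Pi.single i 1) + l (0, Pi.single k 1) := by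
    intro i k
    change _ = l (Pi.single i 1, 0) + l (0, Pi.single k 1)
    rw [← map_add]
    simp
  ext ⟨i, k⟩
  constructor
  · intro h j
    have := h (j, k)
    simp only [hsplit] at this
    linarith
  · intro h jm
    obtain ⟨i₀, hi₀⟩ := hl k
    have h1 := hi₀ jm
    have h2 := h i₀
    simp only [hsplit] at h1 h2 ⊢
    linarith

theorem image_mem_sliceComplex (hn : 1 ≤ n) {V : Matrix (Fin d) (Fin n) ℝ}
    {C : Set (Fin d → ℝ)} (hC : C ∈ matrixSubdivision (V.map ((↑) : ℝ → WithTop ℝ))) :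
    (fun x => ((n : ℝ)⁻¹ • x, (fun _ => (1 : ℝ) / n : Fin n → ℝ))) '' C ∈
      sliceComplex (productSubdivision V) (barycentricSubspace d n) := by
  obtain rfl | hne := C.eq_empty_or_nonempty
  · exact ⟨∅, mem_productSubdivision_iff.2 (Or.inl rfl), by simp⟩
  rcases mem_matrixSubdivision_iff.1 hC with rfl | ⟨a, rfl⟩
  · exact absurd hne Set.not_nonempty_empty
  have hcol : ∀ k, ∃ i, i ∈ columnContact V a k := by
    obtain ⟨x, hx⟩ := convexHull_nonempty_iff.1 hne
    obtain ⟨g, hg, -⟩ := (Set.mem_fintype_sum _ _).1 hx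
    exact fun k => (hg k).imp fun i hi => hi.1
  choose τ hτ using hcol
  -- `b` takes the minimum of column `k` as its value on `e_k`, so that all columns touch the
  -- hyperplane at the common level `0`.
  let b : StrongDual ℝ (Fin n → ℝ) :=
    ∑ k, (V (τ k) k - a (Pi.single (τ k) 1)) • ContinuousLinearMap.proj k
  have hb : ∀ k, b (Pi.single k 1) = V (τ k) k - a (Pi.single (τ k) 1) := by
    intro k
    simp [b, Pi.single_apply]
  let l := a.coprod b
  have hl : ∀ x y, l (x, y) = a x + b y := fun _ _ => rfl
  have hla : l.comp (ContinuousLinearMap.inl ℝ _ _) = a := by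
    ext x
    simp [l]
  refine ⟨_, mem_productSubdivision_iff.2 (Or.inr ⟨l, rfl⟩), ?_⟩
  rw [lowerContact_prod_eq, hla, convexHull_prod_inter_barycentricSubspace hn]
  refine fun k => ⟨τ k, fun jm => ?_⟩
  have := hτ jm.2 jm.1
  simp only [hl, hb]
  linarith

theorem exists_image_eq_of_mem_sliceComplex (hn : 1 ≤ n) {V : Matrix (Fin d) (Fin n) ℝ}
    {D : Set ((Fin d → ℝ) × (Fin n → ℝ))}
    (hD : D ∈ sliceComplex (productSubdivision V) (barycentricSubspace d n)) :
    ∃ C ∈ matrixSubdivision (V.map ((↑) : ℝ → WithTop ℝ)),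
      (fun x => ((n : ℝ)⁻¹ • x, (fun _ => (1 : ℝ) / n : Fin n → ℝ))) '' C = D := by
  obtain rfl | ⟨z, hz⟩ := D.eq_empty_or_nonempty
  · exact ⟨∅, mem_matrixSubdivision_iff.2 (Or.inl rfl), by simp⟩
  obtain ⟨B, hB, rfl⟩ := hD
  rcases mem_productSubdivision_iff.1 hB with rfl | ⟨l, rfl⟩
  · exact hz.1.elim
  refine ⟨_, mem_matrixSubdivision_iff.2
    (Or.inr ⟨l.comp (ContinuousLinearMap.inl ℝ _ _), rfl⟩), ?_⟩
  rw [lowerContact_prod_eq, convexHull_prod_inter_barycentricSubspace hn]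
  intro k
  -- If the contact set missed column `k`, every point of the cell would have `k`-th coordinate `0`
  -- in the second factor, not `1/n`.
  by_contra! hk
  obtain ⟨w, -, hwS, -, hwz⟩ := mem_convexHull_image_iff_exists_weights.1 hz.1
  have hzk : z.2 k = 1 / n := congrFun hz.2 k
  have h0 : z.2 k = 0 := by
    rw [← hwz, Prod.snd_sum, Finset.sum_apply]
    refine Finset.sum_eq_zero fun ⟨i, m⟩ _ => ?_
    by_cases hm : k = m
    · subst hm
      simp [hwS _ (hk i)]
    · simp [Pi.single_eq_of_ne hm]
  rw [h0] at hzk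
  have : (0 : ℝ) < 1 / n := by positivity
  exact this.ne hzk

end CayleyTrick

theorem mainTheorem7 (d n : ℕ) (hn : 1 ≤ n) (V : Matrix (Fin d) (Fin n) ℝ) :
    (FormedFromMixedCells
        (fun _ : Fin n => Set.range fun i : Fin d => (Pi.single i 1 : Fin d → ℝ))
        (matrixSubdivision (V.map ((↑) : ℝ → WithTop ℝ))) ∧
      ⋃₀ matrixSubdivision (V.map ((↑) : ℝ → WithTop ℝ)) = (n : ℝ) • stdSimplex ℝ (Fin d)) ∧
    PLIsomorphic (matrixSubdivision (V.map ((↑) : ℝ → WithTop ℝ)))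
      (sliceComplex (productSubdivision V) (barycentricSubspace d n)) := by

  have hn0 : (n : ℝ) ≠ 0 := by positivity
  refine ⟨⟨fun C hC => ?_, ?_⟩, ?_⟩
  · rcases mem_matrixSubdivision_iff.1 hC with rfl | ⟨a, rfl⟩
    -- Empty labels give the empty cell only because `n ≥ 1`; an empty Minkowski sum would be `{0}`.
    · refine ⟨fun _ => ∅, fun _ => Set.empty_subset _, ?_⟩
      rw [eq_comm, convexHull_eq_empty, Set.eq_empty_iff_forall_notMem]
      intro x hx
      obtain ⟨g, hg, -⟩ := (Set.mem_fintype_sum _ _).1 hx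
      exact hg ⟨0, hn⟩
    · exact ⟨_, fun _ => Set.image_subset_range _ _, rfl⟩
  · rw [matrixSubdivision_eq_regularSubdivision, sUnion_regularSubdivision,
      ← sum_stdSimplex_eq_smul hn, ← convexHull_rangle_single_eq_stdSimplex, ← convexHull_sum]
    congr 1
    ext x
    rw [Set.mem_fintype_sum]
    constructor
    · rintro ⟨σ, rfl⟩
      exact ⟨fun k => Pi.single (σ k) 1, fun k => ⟨σ k, rfl⟩, rfl⟩
    · rintro ⟨g, hg, rfl⟩
      choose σ hσ using fun k => hg k
      exact ⟨σ, Finset.sum_congr rfl fun k _ => hσ k⟩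
  · let f : (Fin d → ℝ) → (Fin d → ℝ) × (Fin n → ℝ) := fun x => ((n : ℝ)⁻¹ • x, fun _ => 1 / n)
    let g : (Fin d → ℝ) × (Fin n → ℝ) → (Fin d → ℝ) := fun z => (n : ℝ) • z.1
    have hgf : ∀ x, g (f x) = x := fun x => by simp [f, g, smul_smul, hn0]
    refine ⟨f, g, Continuous.continuousOn (by fun_prop), Continuous.continuousOn (by fun_prop),
      ⟨fun x _ => hgf x, ?_⟩, fun C hC => ⟨image_mem_sliceComplex hn hC, ?_⟩,
      fun D hD => ⟨?_, ?_⟩⟩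
    · rintro z ⟨_, ⟨B, -, rfl⟩, -, hz⟩
      refine Prod.ext ?_ (Eq.symm hz)
      simp [f, g, smul_smul, hn0]
    · exact ⟨((n : ℝ)⁻¹ • AffineMap.id ℝ (Fin d → ℝ)).prod
        (AffineMap.const ℝ (Fin d → ℝ) fun _ => (1 : ℝ) / n), fun _ _ => rfl⟩
    · obtain ⟨C, hC, rfl⟩ := exists_image_eq_of_mem_sliceComplex hn hD
      change g '' (f '' C) ∈ _
      rw [Set.image_image]
      simpa [hgf] using hC
    · exact ⟨((n : ℝ) • LinearMap.fst ℝ (Fin d → ℝ) (Fin n → ℝ)).toAffineMap, fun _ _ => rfl⟩
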